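/- Let $n\ge 1$ and let $C=[-\tfrac12,\tfrac12]^n\subset\mathbb{R}^n$ be the unit $n$-cube. For a unit vector $u=(u_1,\dots,u_n)\in\mathbb{R}^n$, let $\mathrm{vl}(u)$ denote the $(n-1)$-dimensional volume (Lebesgue measure in $u^\perp$) of the orthogonal projection of $C$ onto the hyperplane $u^\perp$. Then $\mathrm{vl}(u)=|u_1|+\dots+|u_n|$ for every unit vector $u$. If $U$ is a random vector uniformly distributed on the unit sphere of $\mathbb{R}^n$, then $\mathrm{vl}(U)$ and $\mathrm{vl}(U)^2$ are integrable and $$\mathbb{E}(\mathrm{vl}(U))=\frac{n}{\sqrt{\pi}}\,\frac{\Gamma\left(\frac n2\right)}{\Gamma\left(\frac{n+1}2\right)},\qquad \mathbb{E}(\mathrm{vl}(U)^2)=1+\frac{2(n-1)}{\pi}.$$ Moreover, over all unit vectors $u\in\mathbb{R}^n$, $\max \mathrm{vl}(u)=\sqrt n$ and $\min \mathrm{vl}(u)=1$, both being attained. In particular, for $n=4$ and $u=(x,y,z,w)$ we have $\mathrm{vl}(u)=|x|+|y|+|z|+|w|$, and $$\mathbb{E}(\mathrm{vl}(U))=\frac{16}{3\pi},\qquad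 \mathbb{E}(\mathrm{vl}(U)^2)=1+\frac6\pi .$$ -/

import Mathlib

open MeasureTheory ProbabilityTheory

noncomputable section

/-- The unit `n`-cube with edges of length one, centred at the origin of Euclidean `n`-space. -/
def unitCube (n : ℕ) : Set (EuclideanSpace ℝ (Fin n)) :=
  {x | ∀ i, |x i| ≤ 1 / 2}

/-- The hyperplane of all vectors orthogonal to `u`. -/
abbrev hyperplane {n : ℕ} (u : EuclideanSpace ℝ (Fin n)) :
    Submodule ℝ (EuclideanSpace ℝ (Fin n)) :=
  (Submodule.span ℝ {u})ᗮ

/-- The orthogonal projection of the unit `n`-cube to the hyperplane orthogonal to `u`,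
as a subset of that hyperplane. -/
def projectedCube {n : ℕ} (u : EuclideanSpace ℝ (Fin n)) : Set (hyperplane u) :=
  (hyperplane u).orthogonalProjectionOnto '' unitCube n

/-- The `(n - 1)`-dimensional volume of the orthogonal projection of the unit `n`-cube to the
hyperplane orthogonal to `u`. Here `volume` is the Lebesgue measure of the inner product space
`hyperplane u`: the unit box of an orthonormal basis of the hyperplane has measure one. -/
def vl {n : ℕ} (u : EuclideanSpace ℝ (Fin n)) : ℝ :=
  (volume (projectedCube u)).toReal

/-- The random point `U` is uniformly distributed on the unit sphere of Euclidean `n`-space: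
its law is the normalized surface measure. -/
def IsUniformOnSphere {n : ℕ} {Ω : Type*} [MeasurableSpace Ω] (P : Measure Ω)
    (U : Ω → Metric.sphere (0 : EuclideanSpace ℝ (Fin n)) 1) : Prop :=
  pdf.IsUniform U Set.univ P
    ((volume : Measure (EuclideanSpace ℝ (Fin n))).toSphere)

end

/-!
For a convex body `K` and a unit vector `u`, integrating over the lines parallel to `u` shows that
`vol (K \ (K + t u))` is the integral over the shadow of `K` on `uᗮ` of `min (chord length) t`.
Hence `vol (K \ (K + t u)) / t` tends to the volume of the shadow as `t → 0⁺`. For the cube the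
numerator is `1 - ∏ i, (1 - t |u i|)`, whose derivative at `0` is `∑ i, |u i|`.

If `f` is positively homogeneous of degree `k` and `G` is a standard Gaussian vector, polar
coordinates give `E f(G) = E f(U) * E ‖G‖ ^ k`. Applied to `∑ i, |x i|` and its square, whose
Gaussian expectations come from the mean and variance of the independent variables `|G i|`, this
yields the two moments. The extreme values are the comparison of the `ℓ¹` and `ℓ²` norms.
-/

section Shadow

open Filter Metric Module Set
open scoped ENNReal Pointwise RealInnerProductSpace Topology

theorem volume_sdiff_vadd_of_ordConnected {s : Set ℝ} (hs : s.OrdConnected) (hb : BddBelow s)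
    {t : ℝ} (ht : 0 ≤ t) : volume (s \ (t +ᵥ s)) = min (volume s) (ENNReal.ofReal t) := by
  have mem_vadd (x : ℝ) : x ∈ t +ᵥ s ↔ x - t ∈ s := by
    rw [mem_vadd_set_iff_neg_vadd_mem, vadd_eq_add, neg_add_eq_sub]
  by_cases h : ∃ y ∈ s, sInf s + t ≤ y
  · obtain ⟨y, hy, hty⟩ := h
    have lower : Ioo (sInf s) (sInf s + t) ⊆ s \ (t +ᵥ s) := by
      rintro x ⟨hx, hxt⟩
      obtain ⟨z, hz, hzx⟩ := exists_lt_of_csInf_lt ⟨y, hy⟩ hx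
      refine ⟨hs.out hz hy ⟨hzx.le, hxt.le.trans hty⟩, fun hx' => ?_⟩
      linarith [csInf_le hb ((mem_vadd x).1 hx')]
    have upper : s \ (t +ᵥ s) ⊆ Icc (sInf s) (sInf s + t) := by
      rintro x ⟨hx, hxt⟩
      refine ⟨csInf_le hb hx, not_lt.1 fun hlt => hxt ((mem_vadd x).2 ?_)⟩
      obtain ⟨z, hz, hzx⟩ := exists_lt_of_csInf_lt ⟨y, hy⟩ (lt_sub_iff_add_lt.2 hlt)
      exact hs.out hz hx ⟨hzx.le, sub_le_self x ht⟩
    have hvol : volume (s \ (t +ᵥ s)) = ENNReal.ofReal t :=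
      le_antisymm ((measure_mono upper).trans (by simp)) (le_trans (by simp) (measure_mono lower))
    rw [hvol, min_eq_right (hvol ▸ measure_mono sdiff_subset)]
  · push Not at h
    have disjoint : Disjoint s (t +ᵥ s) := disjoint_left.2 fun x hx hxt => by
      linarith [h x hx, csInf_le hb ((mem_vadd x).1 hxt)]
    have hsub : s ⊆ Icc (sInf s) (sInf s + t) := fun x hx => ⟨csInf_le hb hx, (h x hx).le⟩
    rw [disjoint.sdiff_eq_left, min_eq_left ((measure_mono hsub).trans (by simp))]

theorem tendsto_min_ofReal_div_ofReal {a : ℝ≥0∞} (ha : a ≠ 0) :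
    Tendsto (fun t : ℝ => min a (ENNReal.ofReal t) / ENNReal.ofReal t) (𝓝[>] 0) (𝓝 1) := by
  have small : ∀ᶠ t in 𝓝[>] (0 : ℝ), ENNReal.ofReal t < a :=
    nhdsWithin_le_nhds
      (ENNReal.continuous_ofReal.tendsto 0 (Iio_mem_nhds (by simpa [pos_iff_ne_zero])))
  refine tendsto_const_nhds.congr' ?_
  filter_upwards [small, self_mem_nhdsWithin] with t ht ht₀
  rw [min_eq_right ht.le, ENNReal.div_self (by simpa using ht₀) ENNReal.ofReal_ne_top]

section Chord

variable {E : Type*} [AddCommGroup E] [Module ℝ E]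

/-- The section of `K` by the line through `y` in the direction `u`, in the parametrization
`s ↦ y + s • u` of that line. -/
def chord (u : E) (K : Set E) (y : E) : Set ℝ :=
  {s | y + s • u ∈ K}

theorem chord_sdiff_vadd (u : E) (K : Set E) (y : E) (t : ℝ) :
    chord u (K \ (t • u +ᵥ K)) y = chord u K y \ (t +ᵥ chord u K y) := by
  ext s
  simp only [chord, Set.mem_sdiff, mem_ofPred_eq, mem_vadd_set_iff_neg_vadd_mem,
    vadd_eq_add, add_smul, neg_smul, add_left_comm y]

theorem ordConnected_chord {K : Set E} (hK : Convex ℝ K) (u y : E) :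
    (chord u K y).OrdConnected :=
  ((hK.translate_preimage_right y).linear_preimage (LinearMap.toSpanSingleton ℝ E u)).ordConnected

theorem isOpen_chord [TopologicalSpace E] [ContinuousAdd E] [ContinuousSMul ℝ E] {K : Set E}
    (hK : IsOpen K) (u y : E) : IsOpen (chord u K y) :=
  hK.preimage (by fun_prop)

theorem isBounded_chord {E : Type*} [NormedAddCommGroup E] [NormedSpace ℝ E] {u : E} (hu : u ≠ 0)
    {K : Set E} (hK : Bornology.IsBounded K) (y : E) : Bornology.IsBounded (chord u K y) := by
  refine AntilipschitzWith.isBounded_preimage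
    (AntilipschitzWith.of_le_mul_dist (K := ‖u‖₊⁻¹) fun s t => ?_) hK
  rw [dist_add_left, dist_eq_norm, dist_eq_norm, ← sub_smul, norm_smul, NNReal.coe_inv, coe_nnnorm,
    mul_comm, mul_inv_cancel_right₀ (norm_ne_zero_iff.2 hu)]

end Chord

variable {E : Type*} [NormedAddCommGroup E] [InnerProductSpace ℝ E]

/-- The orthogonal projection of `K` to the hyperplane orthogonal to `u`, as a subset of that
hyperplane. -/
def shadow (u : E) (K : Set E) : Set (ℝ ∙ u)ᗮ :=
  (ℝ ∙ u)ᗮ.orthogonalProjectionOnto '' K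

variable {u : E} {K : Set E}

theorem mem_shadow_iff_nonempty_chord (hu : ‖u‖ = 1) {y : (ℝ ∙ u)ᗮ} :
    y ∈ shadow u K ↔ (chord u K y).Nonempty := by
  constructor
  · rintro ⟨x, hx, rfl⟩
    have decomposition := (ℝ ∙ u).starProjection_add_starProjection_orthogonal x
    rw [Submodule.starProjection_unit_singleton ℝ hu, add_comm] at decomposition
    exact ⟨⟪u, x⟫, show (ℝ ∙ u)ᗮ.starProjection x + ⟪u, x⟫ • u ∈ K by rwa [decomposition]⟩
  · rintro ⟨s, hs⟩
    have hu_perp : u ∈ (ℝ ∙ u)ᗮᗮ :=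
      Submodule.le_orthogonal_orthogonal _ (Submodule.mem_span_singleton_self u)
    refine ⟨_, hs, ?_⟩
    rw [map_add, map_smul, Submodule.orthogonalProjectionOnto_mem_subspace_eq_self,
      Submodule.orthogonalProjectionOnto_eq_zero_iff.2 hu_perp, smul_zero, add_zero]

variable [FiniteDimensional ℝ E]

theorem isOpen_shadow (hK : IsOpen K) : IsOpen (shadow u K) :=
  (ℝ ∙ u)ᗮ.orthogonalProjectionOnto.isOpenMap (fun y => ⟨y, by simp⟩) K hK

variable [MeasurableSpace E] [BorelSpace E]

theorem measurePreserving_orthogonal_add_smul (hu : ‖u‖ = 1) :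
    MeasurePreserving fun p : (ℝ ∙ u)ᗮ × ℝ => (p.1 : E) + p.2 • u := by
  have line := (LinearIsometryEquiv.toSpanUnitSingleton (𝕜 := ℝ) u hu).measurePreserving
  have sum := (ℝ ∙ u).orthogonalDecomposition.symm.measurePreserving.comp
    (WithLp.volume_preserving_toLp (ℝ ∙ u) (ℝ ∙ u)ᗮ)
  convert sum.comp (Measure.measurePreserving_swap.comp ((MeasurePreserving.id volume).prod line))
    using 1
  · ext p
    simp [add_comm]
  · rfl

theorem measurable_volume_chord (hK : MeasurableSet K) :
    Measurable fun y : (ℝ ∙ u)ᗮ => volume (chord u K y) :=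
  measurable_measure_prodMk_left (ν := (volume : Measure ℝ))
    (hK.preimage (show Measurable fun p : (ℝ ∙ u)ᗮ × ℝ => (p.1 : E) + p.2 • u by fun_prop))

theorem volume_eq_lintegral_volume_chord (hu : ‖u‖ = 1) (hK : MeasurableSet K) :
    volume K = ∫⁻ y : (ℝ ∙ u)ᗮ, volume (chord u K y) := by
  have hmp := measurePreserving_orthogonal_add_smul hu
  rw [← hmp.measure_preimage hK.nullMeasurableSet]
  exact Measure.prod_apply (hmp.measurable hK)

theorem volume_sdiff_vadd_eq_lintegral_min (hu : ‖u‖ = 1) (hK : MeasurableSet K)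
    (hconv : Convex ℝ K) (hbdd : Bornology.IsBounded K) {t : ℝ} (ht : 0 ≤ t) :
    volume (K \ (t • u +ᵥ K)) =
      ∫⁻ y : (ℝ ∙ u)ᗮ, min (volume (chord u K y)) (ENNReal.ofReal t) := by
  have hu₀ : u ≠ 0 := norm_ne_zero_iff.1 (hu ▸ one_ne_zero)
  rw [volume_eq_lintegral_volume_chord hu (hK.diff (hK.const_vadd _))]
  refine lintegral_congr fun y => ?_
  rw [chord_sdiff_vadd, volume_sdiff_vadd_of_ordConnected (ordConnected_chord hconv u y)
    (isBounded_chord hu₀ hbdd y).bddBelow ht]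

theorem tendsto_volume_sdiff_vadd_div_of_isOpen (hu : ‖u‖ = 1) (hK : IsOpen K)
    (hconv : Convex ℝ K) (hbdd : Bornology.IsBounded K) :
    Tendsto (fun t : ℝ => volume (K \ (t • u +ᵥ K)) / ENNReal.ofReal t) (𝓝[>] 0)
      (𝓝 (volume (shadow u K))) := by
  have shadow_finite : volume (shadow u K) ≠ ∞ :=
    ((ℝ ∙ u)ᗮ.orthogonalProjectionOnto.lipschitz.isBounded_image hbdd).measure_lt_top.ne
  have shadow_meas := (isOpen_shadow (u := u) hK).measurableSet
  have chord_empty {y : (ℝ ∙ u)ᗮ} (hy : y ∉ shadow u K) : chord u K y = ∅ :=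
    not_nonempty_iff_eq_empty.1 (mt (mem_shadow_iff_nonempty_chord hu).2 hy)
  have chord_pos {y : (ℝ ∙ u)ᗮ} (hy : y ∈ shadow u K) : volume (chord u K y) ≠ 0 :=
    (isOpen_chord hK _ _).measure_ne_zero _ ((mem_shadow_iff_nonempty_chord hu).1 hy)
  have min_meas (t : ℝ) :
      Measurable fun y : (ℝ ∙ u)ᗮ => min (volume (chord u K y)) (ENNReal.ofReal t) :=
    (measurable_volume_chord hK.measurableSet).min measurable_const
  have limit : Tendsto
      (fun t : ℝ => ∫⁻ y : (ℝ ∙ u)ᗮ,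
        min (volume (chord u K y)) (ENNReal.ofReal t) / ENNReal.ofReal t)
      (𝓝[>] 0) (𝓝 (∫⁻ y, (shadow u K).indicator 1 y)) := by
    refine tendsto_lintegral_filter_of_dominated_convergence ((shadow u K).indicator 1)
      (.of_forall fun t => (min_meas t).div_const _) (.of_forall fun t => .of_forall fun y => ?_)
      (by rwa [lintegral_indicator_one shadow_meas]) (.of_forall fun y => ?_)
    · by_cases hy : y ∈ shadow u K
      · rw [indicator_of_mem hy]
        exact ENNReal.div_le_of_le_mul (by simp)
      · simp [chord_empty hy]
    · by_cases hy : y ∈ shadow u K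
      · rw [indicator_of_mem hy]
        exact tendsto_min_ofReal_div_ofReal (chord_pos hy)
      · simp [chord_empty hy, hy]
  rw [lintegral_indicator_one shadow_meas] at limit
  refine limit.congr' ?_
  filter_upwards [self_mem_nhdsWithin] with t ht
  simp_rw [div_eq_mul_inv]
  rw [lintegral_mul_const _ (min_meas t),
    volume_sdiff_vadd_eq_lintegral_min hu hK.measurableSet hconv hbdd (le_of_lt ht)]

theorem addHaar_image_interior_of_convex {F : Type*} [NormedAddCommGroup F] [NormedSpace ℝ F]
    [FiniteDimensional ℝ F] [MeasurableSpace F] [BorelSpace F] (μ : Measure F)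
    [μ.IsAddHaarMeasure] {E : Type*} [AddCommGroup E] [Module ℝ E] [TopologicalSpace E]
    [IsTopologicalAddGroup E] [ContinuousSMul ℝ E] {K : Set E}
    (hK : Convex ℝ K) (hne : (interior K).Nonempty) (f : E →L[ℝ] F) :
    μ (f '' interior K) = μ (f '' K) := by
  have hconv : Convex ℝ (f '' interior K) := hK.interior.linear_image f.toLinearMap
  have hsub : f '' K ⊆ closure (f '' interior K) := calc
    f '' K ⊆ f '' closure (interior K) := by
      rw [hK.closure_interior_eq_closure_of_nonempty_interior hne]
      exact image_mono subset_closure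
    _ ⊆ closure (f '' interior K) := image_closure_subset_closure_image f.continuous
  have hclosure :=
    measure_congr (closure_ae_eq_of_null_frontier (hconv.addHaar_frontier μ))
  exact le_antisymm (measure_mono (image_mono interior_subset))
    ((measure_mono hsub).trans hclosure.le)

theorem tendsto_volume_sdiff_vadd_div (hu : ‖u‖ = 1) (hconv : Convex ℝ K)
    (hbdd : Bornology.IsBounded K) (hne : (interior K).Nonempty) :
    Tendsto (fun t : ℝ => volume (K \ (t • u +ᵥ K)) / ENNReal.ofReal t) (𝓝[>] 0)
      (𝓝 (volume (shadow u K))) := by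
  have interior_ae_eq {L : Set E} (hL : Convex ℝ L) : interior L =ᵐ[volume] L :=
    interior_ae_eq_of_null_frontier (hL.addHaar_frontier volume)
  have hsdiff (t : ℝ) :
      volume (interior K \ (t • u +ᵥ interior K)) = volume (K \ (t • u +ᵥ K)) := by
    rw [← interior_vadd]
    exact measure_congr ((interior_ae_eq hconv).diff (interior_ae_eq (hconv.vadd _)))
  have hshadow : volume (shadow u (interior K)) = volume (shadow u K) :=
    addHaar_image_interior_of_convex volume hconv hne (ℝ ∙ u)ᗮ.orthogonalProjectionOnto
  simpa only [hsdiff, hshadow] using tendsto_volume_sdiff_vadd_div_of_isOpen hu isOpen_interior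
    hconv.interior (hbdd.subset interior_subset)

end Shadow

section Moments

open Module Real Set
open scoped RealInnerProductSpace

section Haar

variable {E : Type*} [NormedAddCommGroup E] [NormedSpace ℝ E] [FiniteDimensional ℝ E] [Nontrivial E]
  [MeasurableSpace E] [BorelSpace E] (μ : Measure E) [μ.IsAddHaarMeasure]

theorem integral_mul_comp_norm_eq_integral_toSphere_mul {f : E → ℝ} {k : ℝ}
    (hf : ∀ r : ℝ, 0 < r → ∀ x, f (r • x) = r ^ k * f x) (g : ℝ → ℝ) :
    ∫ x, f x * g ‖x‖ ∂μ = (∫ x, f x ∂μ.toSphere) *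
      ∫ r : Ioi (0 : ℝ), r.1 ^ k * g r ∂.volumeIoiPow (finrank ℝ E - 1) := by
  have polar (x : ({0}ᶜ : Set E)) : f x * g ‖x.1‖ =
      f (homeomorphUnitSphereProd E x).1 * ((homeomorphUnitSphereProd E x).2.1 ^ k *
        g (homeomorphUnitSphereProd E x).2) := by
    have hx : 0 < ‖x.1‖ := norm_pos_iff.2 x.2
    rw [homeomorphUnitSphereProd_apply_snd_coe, homeomorphUnitSphereProd_apply_fst_coe,
      ← mul_assoc, mul_comm (f (_ • _)), ← hf _ hx, smul_inv_smul₀ hx.ne']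
  calc ∫ x, f x * g ‖x‖ ∂μ = ∫ x : ({0}ᶜ : Set E), f x * g ‖x.1‖ ∂μ.comap (↑) := by
        rw [integral_subtype_comap (measurableSet_singleton _).compl fun x => f x * g ‖x‖,
          restrict_compl_singleton]
    _ = ∫ p, f p.1 * (p.2.1 ^ k * g p.2) ∂μ.toSphere.prod (.volumeIoiPow (finrank ℝ E - 1)) := by
        simp only [polar]
        exact μ.measurePreserving_homeomorphUnitSphereProd.integral_comp
          (Homeomorph.measurableEmbedding _) fun p => f p.1 * (p.2.1 ^ k * g p.2)
    _ = _ := integral_prod_mul (fun x : Metric.sphere (0 : E) 1 => f x)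
        fun r : Ioi (0 : ℝ) => r.1 ^ k * g r

theorem integral_mul_comp_norm_of_homogeneous {f : E → ℝ} {k : ℝ}
    (hf : ∀ r : ℝ, 0 < r → ∀ x, f (r • x) = r ^ k * f x) (g : ℝ → ℝ) :
    ∫ x, f x * g ‖x‖ ∂μ = (⨍ x, f x ∂μ.toSphere) * ∫ x, ‖x‖ ^ k * g ‖x‖ ∂μ := by
  have norm_homogeneous (r : ℝ) (hr : 0 < r) (x : E) : ‖r • x‖ ^ k = r ^ k * ‖x‖ ^ k := by
    rw [norm_smul, norm_of_nonneg hr.le, mul_rpow hr.le (norm_nonneg x)]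
  have : NeZero μ.toSphere := ⟨μ.toSphere_ne_zero⟩
  have toSphere_univ : μ.toSphere.real univ ≠ 0 := measureReal_univ_ne_zero
  rw [integral_mul_comp_norm_eq_integral_toSphere_mul μ hf,
    integral_mul_comp_norm_eq_integral_toSphere_mul μ norm_homogeneous, average_eq]
  simp only [norm_eq_of_mem_sphere, one_rpow, integral_const, smul_eq_mul, mul_one]
  field_simp

theorem integral_norm_rpow_mul_exp_neg_sq_div_two {k : ℝ} (hk : -finrank ℝ E < k) :
    ∫ x, ‖x‖ ^ k * exp (-‖x‖ ^ 2 / 2) ∂μ =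
      finrank ℝ E * μ.real (Metric.ball 0 1) *
        (2 ^ ((finrank ℝ E + k) / 2) / 2 * Gamma ((finrank ℝ E + k) / 2)) := by
  rw [integral_fun_norm_addHaar μ fun r => r ^ k * exp (-r ^ 2 / 2), nsmul_eq_mul, smul_eq_mul,
    ← mul_assoc]
  congr 1
  have radial : ∀ r ∈ Ioi (0 : ℝ), r ^ (finrank ℝ E - 1) • (r ^ k * exp (-r ^ 2 / 2)) =
      r ^ (finrank ℝ E + k - 1) * exp (-(1 / 2) * r ^ (2 : ℝ)) := fun r (hr : 0 < r) => by
    rw [smul_eq_mul, ← mul_assoc, ← rpow_natCast, ← rpow_add hr, Nat.cast_pred finrank_pos,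
      rpow_two]
    ring_nf
  rw [setIntegral_congr_fun measurableSet_Ioi radial,
    integral_rpow_mul_exp_neg_mul_rpow two_pos (by linarith) (by norm_num), sub_add_cancel,
    one_div, inv_rpow two_pos.le, neg_div, rpow_neg two_pos.le, inv_inv]
  ring

end Haar

section StdGaussian

variable (E : Type*) [NormedAddCommGroup E] [InnerProductSpace ℝ E] [FiniteDimensional ℝ E]
  [MeasurableSpace E] [BorelSpace E]

theorem integrable_exp_neg_norm_sq_div_two : Integrable fun x : E => exp (-‖x‖ ^ 2 / 2) := by
  have hint := GaussianFourier.integral_rexp_neg_mul_sq_norm (V := E) (b := 1 / 2) (by norm_num)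
  refine .of_integral_ne_zero ?_
  ring_nf at hint ⊢
  rw [hint]
  positivity

theorem stdGaussian_eq_tilted :
    stdGaussian E = (volume : Measure E).tilted fun x => -‖x‖ ^ 2 / 2 := by
  have := isProbabilityMeasure_tilted (integrable_exp_neg_norm_sq_div_two E)
  refine Measure.ext_of_charFun (funext fun t => ?_)
  set Z := ∫ x : E, exp (-‖x‖ ^ 2 / 2)
  have hZ : (Z : ℂ) ≠ 0 :=
    Complex.ofReal_ne_zero.2 (integral_exp_pos (integrable_exp_neg_norm_sq_div_two E)).ne'
  have fourier (t : E) :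
      ∫ x : E, (exp (-‖x‖ ^ 2 / 2) : ℂ) * Complex.exp (⟪x, t⟫ * Complex.I) =
        (π / (1 / 2 : ℂ)) ^ (finrank ℝ E / 2 : ℂ) * Complex.exp (-‖t‖ ^ 2 / 2) := by
    convert GaussianFourier.integral_cexp_neg_mul_sq_norm_add (V := E) (b := 1 / 2) (by norm_num)
      Complex.I t using 3 with x
    · rw [Complex.ofReal_exp, ← Complex.exp_add, real_inner_comm]
      push_cast
      ring_nf
    · rw [Complex.I_sq]
      ring_nf
  have hZ_eq : (Z : ℂ) = (π / (1 / 2 : ℂ)) ^ (finrank ℝ E / 2 : ℂ) := by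
    rw [← integral_complex_ofReal]
    simpa using fourier 0
  simp_rw [charFun_stdGaussian, charFun_apply, integral_tilted, Complex.real_smul,
    Complex.ofReal_div, div_mul_eq_mul_div]
  rw [integral_div, fourier, ← hZ_eq, mul_div_cancel_left₀ _ hZ]

theorem stdGaussian_real : stdGaussian ℝ = gaussianReal 0 1 := by
  refine Measure.ext_of_charFun (funext fun t => ?_)
  rw [charFun_stdGaussian, charFun_gaussianReal]
  simp [neg_div, ← Complex.ofReal_pow]

end StdGaussian

section Homogeneous

variable {E : Type*} [NormedAddCommGroup E] [InnerProductSpace ℝ E] [FiniteDimensional ℝ E]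
  [MeasurableSpace E] [BorelSpace E] [Nontrivial E]

theorem integral_stdGaussian_of_homogeneous {f : E → ℝ} {k : ℝ}
    (hf : ∀ r : ℝ, 0 < r → ∀ x, f (r • x) = r ^ k * f x) :
    ∫ x, f x ∂stdGaussian E =
      (⨍ x, f x ∂(volume : Measure E).toSphere) * ∫ x, ‖x‖ ^ k ∂stdGaussian E := by
  simp only [stdGaussian_eq_tilted, integral_tilted, smul_eq_mul, mul_comm (_ / _)]
  exact integral_mul_comp_norm_of_homogeneous volume hf fun r =>
    exp (-r ^ 2 / 2) / ∫ x : E, exp (-‖x‖ ^ 2 / 2)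

variable (E) in
theorem integral_norm_rpow_stdGaussian {k : ℝ} (hk : -finrank ℝ E < k) :
    ∫ x, ‖x‖ ^ k ∂stdGaussian E =
      2 ^ (k / 2) * (Gamma ((finrank ℝ E + k) / 2) / Gamma (finrank ℝ E / 2)) := by
  have hd : (0 : ℝ) < finrank ℝ E := Nat.cast_pos.2 finrank_pos
  have hball : volume.real (Metric.ball (0 : E) 1) ≠ 0 :=
    (ENNReal.toReal_pos (Metric.measure_ball_pos volume 0 one_pos).ne' measure_ball_lt_top.ne).ne'
  have hGamma : Gamma (finrank ℝ E / 2) ≠ 0 := (Gamma_pos_of_pos (half_pos hd)).ne'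
  have normalization := integral_norm_rpow_mul_exp_neg_sq_div_two (volume : Measure E) (k := 0)
    (neg_lt_zero.2 hd)
  simp only [rpow_zero, one_mul, add_zero] at normalization
  simp only [stdGaussian_eq_tilted, integral_tilted, smul_eq_mul, div_mul_eq_mul_div,
    mul_comm (exp _)]
  rw [integral_div, integral_norm_rpow_mul_exp_neg_sq_div_two volume hk, normalization, add_div,
    rpow_add two_pos]
  field_simp

end Homogeneous

section SumAbsMoments

theorem integral_abs_gaussianReal : ∫ x, |x| ∂gaussianReal 0 1 = √(2 / π) := by
  have := integral_norm_rpow_stdGaussian ℝ (k := 1) (by simp)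
  simp only [stdGaussian_real, rpow_one, norm_eq_abs, finrank_self, Nat.cast_one] at this
  rw [this, ← sqrt_eq_rpow, Gamma_one_half_eq, sqrt_div two_pos.le]
  norm_num [div_eq_mul_inv]

theorem memLp_abs_gaussianReal : MemLp (fun x => |x|) 2 (gaussianReal 0 1) :=
  (memLp_id_gaussianReal 2).abs

theorem variance_abs_gaussianReal : Var[fun x => |x|; gaussianReal 0 1] = 1 - 2 / π := by
  have second_moment : ∫ x, x ^ 2 ∂gaussianReal 0 1 = 1 := by
    simpa [variance_eq_sub (memLp_id_gaussianReal 2)] using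
      variance_id_gaussianReal (μ := 0) (v := 1)
  rw [variance_eq_sub memLp_abs_gaussianReal, integral_abs_gaussianReal, sq_sqrt (by positivity)]
  simp [second_moment]

variable (ι : Type*) [Fintype ι]

theorem integral_sum_abs_stdGaussian :
    ∫ x, ∑ i, |x i| ∂stdGaussian (EuclideanSpace ℝ ι) = Fintype.card ι * √(2 / π) := by
  have hint : Integrable (fun x => |x|) (gaussianReal 0 1) :=
    memLp_abs_gaussianReal.integrable one_le_two
  rw [← map_pi_eq_stdGaussian, integral_map (by fun_prop) (by fun_prop),
    integral_finsetSum _ fun i _ => integrable_comp_eval hint]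
  simp_rw [integral_comp_eval (μ := fun _ : ι => gaussianReal 0 1) (f := fun x => |x|)
    hint.aestronglyMeasurable, integral_abs_gaussianReal]
  simp

theorem integral_sum_abs_sq_stdGaussian :
    ∫ x, (∑ i, |x i|) ^ 2 ∂stdGaussian (EuclideanSpace ℝ ι) =
      Fintype.card ι * (1 - 2 / π) + (Fintype.card ι * √(2 / π)) ^ 2 := by
  have mean := integral_sum_abs_stdGaussian ι
  have variance := variance_sum_pi (μ := fun _ : ι => gaussianReal 0 1)
    fun _ => memLp_abs_gaussianReal
  have hmemLp : MemLp (∑ i, fun x : ι → ℝ => |x i|) 2 (.pi fun _ => gaussianReal 0 1) :=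
    memLp_finsetSum' _ fun i _ =>
      memLp_abs_gaussianReal.comp_measurePreserving (measurePreserving_eval _ i)
  rw [← map_pi_eq_stdGaussian, integral_map (by fun_prop) (by fun_prop)] at mean ⊢
  rw [variance_eq_sub hmemLp] at variance
  simp only [variance_abs_gaussianReal, Finset.sum_const, Finset.card_univ, nsmul_eq_mul,
    Pi.pow_apply, Finset.sum_apply] at variance mean ⊢
  rw [← mean, ← variance, sub_add_cancel]

variable [Nonempty ι]

theorem average_sum_abs_toSphere :
    ⨍ x, ∑ i, |x.1 i| ∂(volume : Measure (EuclideanSpace ℝ ι)).toSphere =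
      Fintype.card ι / √π * (Gamma (Fintype.card ι / 2) / Gamma ((Fintype.card ι + 1) / 2)) := by
  have homogeneous (r : ℝ) (hr : 0 < r) (x : EuclideanSpace ℝ ι) :
      ∑ i, |(r • x) i| = r ^ (1 : ℝ) * ∑ i, |x i| := by
    simp [abs_mul, abs_of_pos hr, Finset.mul_sum]
  have gaussian :=
    integral_stdGaussian_of_homogeneous (f := fun x : EuclideanSpace ℝ ι => ∑ i, |x i|)
      homogeneous
  have hd : (0 : ℝ) < Fintype.card ι := Nat.cast_pos.2 Fintype.card_pos
  rw [integral_sum_abs_stdGaussian,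
    integral_norm_rpow_stdGaussian _ (by rw [finrank_euclideanSpace]; linarith),
    finrank_euclideanSpace, ← sqrt_eq_rpow, sqrt_div two_pos.le] at gaussian
  field_simp at gaussian ⊢
  linarith

theorem average_sum_abs_sq_toSphere :
    ⨍ x, (∑ i, |x.1 i|) ^ 2 ∂(volume : Measure (EuclideanSpace ℝ ι)).toSphere =
      1 + 2 * (Fintype.card ι - 1) / π := by
  have homogeneous (r : ℝ) (hr : 0 < r) (x : EuclideanSpace ℝ ι) :
      (∑ i, |(r • x) i|) ^ 2 = r ^ (2 : ℝ) * (∑ i, |x i|) ^ 2 := by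
    simp [abs_mul, abs_of_pos hr, ← Finset.mul_sum, mul_pow]
  have gaussian :=
    integral_stdGaussian_of_homogeneous (f := fun x : EuclideanSpace ℝ ι => (∑ i, |x i|) ^ 2)
      homogeneous
  have hd : (0 : ℝ) < Fintype.card ι := Nat.cast_pos.2 Fintype.card_pos
  rw [integral_sum_abs_sq_stdGaussian,
    integral_norm_rpow_stdGaussian _ (by rw [finrank_euclideanSpace]; linarith),
    finrank_euclideanSpace, add_div, div_self two_ne_zero, rpow_one, Gamma_add_one (by positivity),
    mul_div_cancel_right₀ _ (Gamma_pos_of_pos (by positivity)).ne', mul_pow,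
    sq_sqrt (by positivity)] at gaussian
  field_simp at gaussian ⊢
  linarith

end SumAbsMoments

end Moments

section SumAbs

open Real

variable {ι : Type*} [Fintype ι]

theorem norm_le_sum_abs (x : EuclideanSpace ℝ ι) : ‖x‖ ≤ ∑ i, |x i| := by
  rw [EuclideanSpace.norm_eq]
  exact (sqrt_le_left (Finset.sum_nonneg fun i _ => abs_nonneg _)).2 <|
    Finset.sum_sq_le_sq_sum_of_nonneg fun i _ => abs_nonneg _

theorem sum_abs_le_sqrt_card_mul_norm (x : EuclideanSpace ℝ ι) :
    ∑ i, |x i| ≤ √(Fintype.card ι) * ‖x‖ := by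
  rw [EuclideanSpace.norm_eq, ← sqrt_mul (Nat.cast_nonneg _)]
  exact le_sqrt_of_sq_le sq_sum_le_card_mul_sum_sq

end SumAbs

section Cube

open Filter Set
open scoped ENNReal Pointwise Topology

theorem volume_setOf_forall_mem {ι : Type*} [Fintype ι] (s : ι → Set ℝ) :
    volume {x : EuclideanSpace ℝ ι | ∀ i, x i ∈ s i} = ∏ i, volume (s i) := by
  rw [← volume_pi_pi, ← MeasurePreserving.measure_preimage_equiv
    (f := MeasurableEquiv.toLp 2 (ι → ℝ)) (PiLp.volume_preserving_toLp ι)]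
  congr 1
  ext x
  simp

theorem volume_Icc_inter_vadd (a b c : ℝ) :
    volume (Icc a b ∩ (c +ᵥ Icc a b)) = ENNReal.ofReal (b - a - |c|) := by
  rw [← image_vadd]
  simp only [vadd_eq_add, image_const_add_Icc, Icc_inter_Icc, Real.volume_Icc]
  congr 1
  rcases le_total 0 c with h | h
  · rw [min_eq_left (by linarith), max_eq_right (by linarith), abs_of_nonneg h]; ring
  · rw [min_eq_right (by linarith), max_eq_left (by linarith), abs_of_nonpos h]; ring

variable {n : ℕ}

theorem mem_unitCube_iff {x : EuclideanSpace ℝ (Fin n)} :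
    x ∈ unitCube n ↔ ∀ i, x i ∈ Icc (-(1 / 2) : ℝ) (1 / 2) :=
  forall_congr' fun _ => abs_le

theorem unitCube_eq_preimage_closedBall :
    unitCube n = EuclideanSpace.equiv (Fin n) ℝ ⁻¹' Metric.closedBall 0 (1 / 2) := by
  ext x
  simp [unitCube, pi_norm_le_iff_of_nonneg]

theorem convex_unitCube : Convex ℝ (unitCube n) := by
  rw [unitCube_eq_preimage_closedBall]
  exact (convex_closedBall 0 _).linear_preimage (EuclideanSpace.equiv (Fin n) ℝ).toLinearMap

theorem isBounded_unitCube : Bornology.IsBounded (unitCube n) := by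
  rw [unitCube_eq_preimage_closedBall]
  exact (EuclideanSpace.equiv (Fin n) ℝ).antilipschitz.isBounded_preimage
    Metric.isBounded_closedBall

theorem interior_unitCube_nonempty : (interior (unitCube n)).Nonempty := by
  rw [unitCube_eq_preimage_closedBall]
  refine ⟨0, preimage_interior_subset_interior_preimage
    (EuclideanSpace.equiv (Fin n) ℝ).continuous ?_⟩
  exact Metric.ball_subset_interior_closedBall (by simp)

theorem measurableSet_unitCube : MeasurableSet (unitCube n) := by
  rw [unitCube_eq_preimage_closedBall]
  exact Metric.isClosed_closedBall.measurableSet.preimage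
    (EuclideanSpace.equiv (Fin n) ℝ).continuous.measurable

theorem volume_unitCube_sdiff_vadd (v : EuclideanSpace ℝ (Fin n)) :
    volume (unitCube n \ (v +ᵥ unitCube n)) = 1 - ∏ i, ENNReal.ofReal (1 - |v i|) := by
  have volume_unitCube : volume (unitCube n) = 1 := by
    rw [show unitCube n = {x | ∀ i, x i ∈ Icc (-(1 / 2) : ℝ) (1 / 2)} from
      Set.ext fun _ => mem_unitCube_iff, volume_setOf_forall_mem]
    norm_num
  have volume_inter :
      volume (unitCube n ∩ (v +ᵥ unitCube n)) = ∏ i, ENNReal.ofReal (1 - |v i|) := by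
    have box : unitCube n ∩ (v +ᵥ unitCube n) =
        {x | ∀ i, x i ∈ Icc (-(1 / 2) : ℝ) (1 / 2) ∩ (v i +ᵥ Icc (-(1 / 2) : ℝ) (1 / 2))} := by
      ext x
      simp only [mem_inter_iff, mem_vadd_set_iff_neg_vadd_mem, mem_unitCube_iff, ← forall_and]
      rfl
    rw [box, volume_setOf_forall_mem]
    simp only [volume_Icc_inter_vadd]
    norm_num
  have hfin : volume (unitCube n ∩ (v +ᵥ unitCube n)) ≠ ∞ :=
    measure_ne_top_of_subset inter_subset_left (volume_unitCube ▸ ENNReal.one_ne_top)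
  rw [← sdiff_self_inter, measure_sdiff inter_subset_left
    (measurableSet_unitCube.inter (measurableSet_unitCube.const_vadd v)).nullMeasurableSet hfin,
    volume_unitCube, volume_inter]

theorem hasDerivAt_one_sub_prod_one_sub_mul {ι : Type*} [Fintype ι] (a : ι → ℝ) :
    HasDerivAt (fun t : ℝ => 1 - ∏ i, (1 - t * a i)) (∑ i, a i) 0 := by
  classical
  have factor (i : ι) : HasDerivAt (fun t : ℝ => 1 - t * a i) (-a i) 0 := by
    simpa using ((hasDerivAt_id (0 : ℝ)).mul_const (a i)).const_sub 1
  simpa using (HasDerivAt.fun_finsetProd (u := Finset.univ) fun i _ => factor i).const_sub 1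

theorem tendsto_volume_unitCube_sdiff_vadd_div (u : EuclideanSpace ℝ (Fin n)) :
    Tendsto (fun t : ℝ => volume (unitCube n \ (t • u +ᵥ unitCube n)) / ENNReal.ofReal t)
      (𝓝[>] 0) (𝓝 (ENNReal.ofReal (∑ i, |u i|))) := by
  have small : ∀ᶠ t in 𝓝[>] (0 : ℝ), ∀ i, t * |u i| ≤ 1 :=
    nhdsWithin_le_nhds <| eventually_all.2 fun i =>
      ((continuous_mul_const |u i|).tendsto 0).eventually_le_const (by simp)
  have limit := (ENNReal.continuous_ofReal.tendsto _).comp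
    (hasDerivAt_one_sub_prod_one_sub_mul fun i => |u i|).tendsto_slope_zero_right
  refine limit.congr' ?_
  filter_upwards [small, self_mem_nhdsWithin] with t hsmall ht
  have ht : 0 < t := ht
  have factor_nonneg (i : Fin n) : 0 ≤ 1 - t * |u i| := sub_nonneg.2 (hsmall i)
  have volume_eq : volume (unitCube n \ (t • u +ᵥ unitCube n)) =
      ENNReal.ofReal (1 - ∏ i, (1 - t * |u i|)) := by
    rw [ENNReal.ofReal_sub _ (Finset.prod_nonneg fun i _ => factor_nonneg i),
      ENNReal.ofReal_prod_of_nonneg fun i _ => factor_nonneg i, ENNReal.ofReal_one]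
    simp only [volume_unitCube_sdiff_vadd, PiLp.smul_apply, smul_eq_mul, abs_mul, abs_of_pos ht]
  rw [volume_eq, ← ENNReal.ofReal_div_of_pos ht]
  simp [div_eq_inv_mul]

theorem volume_projectedCube {u : EuclideanSpace ℝ (Fin n)} (hu : ‖u‖ = 1) :
    volume (projectedCube u) = ENNReal.ofReal (∑ i, |u i|) :=
  tendsto_nhds_unique
    (tendsto_volume_sdiff_vadd_div hu convex_unitCube isBounded_unitCube interior_unitCube_nonempty)
    (tendsto_volume_unitCube_sdiff_vadd_div u)

theorem vl_eq_sum_abs {u : EuclideanSpace ℝ (Fin n)} (hu : ‖u‖ = 1) : vl u = ∑ i, |u i| := by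
  rw [vl, volume_projectedCube hu,
    ENNReal.toReal_ofReal (Finset.sum_nonneg fun i _ => abs_nonneg _)]

end Cube

section Extremes

variable (n : ℕ) [NeZero n]

theorem isGreatest_range_vl :
    IsGreatest (Set.range fun u : Metric.sphere (0 : EuclideanSpace ℝ (Fin n)) 1 => vl u.1) √n := by
  have hn : (0 : ℝ) < n := Nat.cast_pos.2 (NeZero.pos n)
  constructor
  · have diagonal_norm : ‖(WithLp.toLp 2 fun _ => (√n)⁻¹ : EuclideanSpace ℝ (Fin n))‖ = 1 := by
      simp [EuclideanSpace.norm_eq, hn.le, hn.ne']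
    refine ⟨⟨_, mem_sphere_zero_iff_norm.2 diagonal_norm⟩, ?_⟩
    simp [vl_eq_sum_abs diagonal_norm, abs_of_nonneg, ← div_eq_mul_inv]
  · rintro _ ⟨u, rfl⟩
    have hu : ‖u.1‖ = 1 := norm_eq_of_mem_sphere u
    simpa [vl_eq_sum_abs hu, hu] using sum_abs_le_sqrt_card_mul_norm u.1

theorem isLeast_range_vl :
    IsLeast (Set.range fun u : Metric.sphere (0 : EuclideanSpace ℝ (Fin n)) 1 => vl u.1) 1 := by
  constructor
  · have axis_norm : ‖EuclideanSpace.single (0 : Fin n) (1 : ℝ)‖ = 1 := by simp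
    refine ⟨⟨_, mem_sphere_zero_iff_norm.2 axis_norm⟩, ?_⟩
    simp [vl_eq_sum_abs axis_norm, apply_ite]
  · rintro _ ⟨u, rfl⟩
    have hu : ‖u.1‖ = 1 := norm_eq_of_mem_sphere u
    simpa [vl_eq_sum_abs hu, hu] using norm_le_sum_abs u.1

end Extremes

theorem continuous_vl {n : ℕ} :
    Continuous fun u : Metric.sphere (0 : EuclideanSpace ℝ (Fin n)) 1 => vl u.1 := by
  simp only [vl_eq_sum_abs (norm_eq_of_mem_sphere _)]
  fun_prop

namespace IsUniformOnSphere

open Real Set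

variable {n : ℕ} {Ω : Type*} [MeasurableSpace Ω] {P : Measure Ω}
  {U : Ω → Metric.sphere (0 : EuclideanSpace ℝ (Fin n)) 1}

theorem map_eq (hU : IsUniformOnSphere P U) :
    P.map U =
      ((volume : Measure (EuclideanSpace ℝ (Fin n))).toSphere univ)⁻¹ • volume.toSphere := by
  rw [show P.map U = _ from hU, ProbabilityTheory.cond, Measure.restrict_univ]

variable [NeZero n]

theorem aemeasurable (hU : IsUniformOnSphere P U) : AEMeasurable U P :=
  pdf.IsUniform.aemeasurable
    (Measure.measure_univ_ne_zero.2 (volume : Measure (EuclideanSpace ℝ (Fin n))).toSphere_ne_zero)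
    (measure_ne_top _ _) hU

theorem integrable_comp (hU : IsUniformOnSphere P U)
    {f : Metric.sphere (0 : EuclideanSpace ℝ (Fin n)) 1 → ℝ} (hf : Continuous f) :
    Integrable (fun ω => f (U ω)) P := by
  have : IsFiniteMeasure (P.map U) := by
    rw [show P.map U = _ from hU]
    infer_instance
  exact (hf.integrable_of_hasCompactSupport (.of_compactSpace f)).comp_aemeasurable hU.aemeasurable

theorem integral_comp (hU : IsUniformOnSphere P U)
    {f : Metric.sphere (0 : EuclideanSpace ℝ (Fin n)) 1 → ℝ} (hf : Continuous f) :
    ∫ ω, f (U ω) ∂P = ⨍ x, f x ∂(volume : Measure (EuclideanSpace ℝ (Fin n))).toSphere := by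
  rw [← integral_map hU.aemeasurable hf.aestronglyMeasurable, hU.map_eq, average]

theorem integrable_vl (hU : IsUniformOnSphere P U) : Integrable (fun ω => vl (U ω).1) P :=
  hU.integrable_comp continuous_vl

theorem integrable_vl_sq (hU : IsUniformOnSphere P U) :
    Integrable (fun ω => vl (U ω).1 ^ 2) P :=
  hU.integrable_comp (continuous_vl.pow 2)

theorem integral_vl (hU : IsUniformOnSphere P U) :
    ∫ ω, vl (U ω).1 ∂P = n / √π * (Gamma (n / 2) / Gamma ((n + 1) / 2)) := by
  rw [hU.integral_comp continuous_vl]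
  simpa only [vl_eq_sum_abs (norm_eq_of_mem_sphere _), Fintype.card_fin] using
    average_sum_abs_toSphere (Fin n)

theorem integral_vl_sq (hU : IsUniformOnSphere P U) :
    ∫ ω, vl (U ω).1 ^ 2 ∂P = 1 + 2 * (n - 1) / π := by
  refine (hU.integral_comp (continuous_vl.pow 2)).trans ?_
  simpa only [Pi.pow_apply, vl_eq_sum_abs (norm_eq_of_mem_sphere _), Fintype.card_fin]
    using average_sum_abs_sq_toSphere (Fin n)

end IsUniformOnSphere

theorem gamma_five_halves : Real.Gamma (5 / 2) = 3 / 4 * √Real.pi := by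
  rw [show (5 / 2 : ℝ) = 1 / 2 + 1 + 1 by norm_num, Real.Gamma_add_one (by norm_num),
    Real.Gamma_add_one (by norm_num), Real.Gamma_one_half_eq]
  ring

theorem mainTheorem1 :
    -- dimension four
    ((∀ u : Metric.sphere (0 : EuclideanSpace ℝ (Fin 4)) 1,
        vl u.1 = |u.1 0| + |u.1 1| + |u.1 2| + |u.1 3|) ∧
      ∀ (Ω : Type*) [MeasurableSpace Ω] (P : Measure Ω) [IsProbabilityMeasure P]
        (U : Ω → Metric.sphere (0 : EuclideanSpace ℝ (Fin 4)) 1),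
        IsUniformOnSphere P U →
          Integrable (fun ω => vl (U ω).1) P ∧
          ∫ ω, vl (U ω).1 ∂P = 16 / (3 * Real.pi) ∧
          Integrable (fun ω => vl (U ω).1 ^ 2) P ∧
          ∫ ω, vl (U ω).1 ^ 2 ∂P = 1 + 6 / Real.pi) ∧
    -- every dimension
    ∀ n : ℕ, 1 ≤ n →
      (∀ u : Metric.sphere (0 : EuclideanSpace ℝ (Fin n)) 1, vl u.1 = ∑ i, |u.1 i|) ∧
      (∀ (Ω : Type*) [MeasurableSpace Ω] (P : Measure Ω) [IsProbabilityMeasure P]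
        (U : Ω → Metric.sphere (0 : EuclideanSpace ℝ (Fin n)) 1),
        IsUniformOnSphere P U →
          Integrable (fun ω => vl (U ω).1) P ∧
          ∫ ω, vl (U ω).1 ∂P =
            (n : ℝ) / Real.sqrt Real.pi *
              (Real.Gamma ((n : ℝ) / 2) / Real.Gamma (((n : ℝ) + 1) / 2)) ∧
          Integrable (fun ω => vl (U ω).1 ^ 2) P ∧
          ∫ ω, vl (U ω).1 ^ 2 ∂P = 1 + 2 * ((n : ℝ) - 1) / Real.pi) ∧
      IsGreatest
        (Set.range fun u : Metric.sphere (0 : EuclideanSpace ℝ (Fin n)) 1 => vl u.1)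
        (Real.sqrt n) ∧
      IsLeast
        (Set.range fun u : Metric.sphere (0 : EuclideanSpace ℝ (Fin n)) 1 => vl u.1)
        1 := by
  have vl_eq {n : ℕ} (u : Metric.sphere (0 : EuclideanSpace ℝ (Fin n)) 1) :
      vl u.1 = ∑ i, |u.1 i| := vl_eq_sum_abs (norm_eq_of_mem_sphere u)
  refine ⟨⟨fun u => ?_, fun Ω _ P _ U hU => ?_⟩, fun n hn => ?_⟩
  · rw [vl_eq, Fin.sum_univ_four]
  · refine ⟨hU.integrable_vl, ?_, hU.integrable_vl_sq, ?_⟩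
    · rw [hU.integral_vl]
      norm_num [gamma_five_halves]
      field_simp
      rw [Real.sq_sqrt Real.pi_pos.le]
      ring
    · rw [hU.integral_vl_sq]
      norm_num
  · have : NeZero n := ⟨Nat.pos_iff_ne_zero.1 hn⟩
    exact ⟨vl_eq, fun Ω _ P _ U hU =>
      ⟨hU.integrable_vl, hU.integral_vl, hU.integrable_vl_sq, hU.integral_vl_sq⟩,
      isGreatest_range_vl n, isLeast_range_vl n⟩
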